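/- For a positive integer $N$ let $$\Gamma_0(N)^+=\left\{ e^{-1/2}\begin{pmatrix} a&b\\ c&d\end{pmatrix}\in \mathrm{SL}(2,\mathbb R) : a,b,c,d,e\in\mathbb Z,\ e>0,\ ad-bc=e,\ e\mid N,\ e\mid a,\ e\mid d,\ N\mid c\right\},$$ let $\overline{\Gamma_0(N)^+}=\Gamma_0(N)^+/\{\pm \mathrm{Id}\}$, and let $X_N=\overline{\Gamma_0(N)^+}\backslash\mathbb H$, where $\mathbb H$ is the upper half plane. For square-free $N$ the surface $X_N$ has exactly one cusp, $i\infty$, of width one; $X_N$ has genus zero if its compactification by this cusp is homeomorphic to the Riemann sphere. A point $e\in\mathbb H$ is elliptic if it is fixed by an elliptic element of $\Gamma_0(N)^+$, and its order $\mathrm{ord}(e)$ is the order of its stabilizer in $\overline{\Gamma_0(N)^+}$; both notions depend only on the class of $e$ in $X_N$, and $\mathcal E_N\subset X_N$ denotes the set of classes of elliptic points. The Hauptmodul $j_N$ is the $\Gamma_0(N)^+$-invariant holomorphic function on $\mathbb H$ with an expansion $j_N(z)=q^{-1}+\sum_{k\ge 1}a_kq^k$, $q=e^{2\pi i z}$,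 and $j_N'$ is its derivative with respect to $z$. Proposition. Let $N$ be a square-free positive integer such that $X_N$ has genus zero. Then: (1) The zeros of $j_N'$ in $\mathbb H$ are exactly the elliptic points; that is, the set of zeros of $j_N'$ on $X_N$ is $\mathcal E_N$. (2) If $X_N$ has no elliptic point of order $4$ or $6$, then $j_N'$ vanishes at every $e\in\mathcal E_N$ to order $\mathrm{ord}(e)-1$. (3) If $X_N$ has an elliptic point of order $4$ or $6$, then either $j_N'$ vanishes at every $e\in\mathcal E_N$ to order $\mathrm{ord}(e)-1$, or there is a point $e_1\in\mathcal E_N$ of order two at which $j_N'$ vanishes to order $2$, $j_N'$ vanishes to order $1$ at every other point of $\mathcal E_N$ of order two, and $j_N'$ vanishes to order $1$ at every point of order $4$ and to order $2$ at every point of order $6$ of $\mathcal E_N$. -/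

import Mathlib

noncomputable section

namespace GenusZero

open UpperHalfPlane Matrix
open scoped MatrixGroups Manifold

/-- `γ = e^{-1/2} (a b; c d)` with integers `a, b, c, d, e` such that `e > 0`, `ad - bc = e`,
`e ∣ N`, `e ∣ a`, `e ∣ d` and `N ∣ c`. -/
def MemGamma0Plus (N : ℕ) (γ : SL(2, ℝ)) : Prop :=
  ∃ a b c d e : ℤ, 0 < e ∧ a * d - b * c = e ∧ e ∣ (N : ℤ) ∧ e ∣ a ∧ e ∣ d ∧ (N : ℤ) ∣ c ∧
    (γ : Matrix (Fin 2) (Fin 2) ℝ) = (√(e : ℝ))⁻¹ • !![(a : ℝ), (b : ℝ); (c : ℝ), (d : ℝ)]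

theorem memGamma0Plus_one (N : ℕ) : MemGamma0Plus N 1 := by
  refine ⟨1, 0, 0, 1, 1, by norm_num, by norm_num, one_dvd _, one_dvd _, one_dvd _,
    dvd_zero _, ?_⟩
  ext i j
  fin_cases i <;> fin_cases j <;> simp

theorem memGamma0Plus_inv {N : ℕ} {γ : SL(2, ℝ)} (h : MemGamma0Plus N γ) :
    MemGamma0Plus N γ⁻¹ := by
  obtain ⟨a, b, c, d, e, he, hdet, heN, hea, hed, hNc, hγ⟩ := h
  refine ⟨d, -b, -c, a, e, he, by linarith, heN, hed, hea, (dvd_neg).2 hNc, ?_⟩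
  rw [Matrix.SpecialLinearGroup.coe_inv, hγ, Matrix.adjugate_fin_two]
  ext i j
  fin_cases i <;> fin_cases j <;> simp

theorem memGamma0Plus_mul {N : ℕ} {γ₁ γ₂ : SL(2, ℝ)} (h₁ : MemGamma0Plus N γ₁)
    (h₂ : MemGamma0Plus N γ₂) : MemGamma0Plus N (γ₁ * γ₂) := by
  obtain ⟨a₁, b₁, c₁, d₁, e₁, he₁, hdet₁, heN₁, ⟨p₁, rfl⟩, ⟨s₁, rfl⟩, ⟨r₁, rfl⟩, hγ₁⟩ := h₁
  obtain ⟨a₂, b₂, c₂, d₂, e₂, he₂, hdet₂, heN₂, ⟨p₂, rfl⟩, ⟨s₂, rfl⟩, ⟨r₂, rfl⟩, hγ₂⟩ := h₂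
  obtain ⟨g, f₁, f₂, hg, hcop, rfl, rfl⟩ : ∃ g f₁ f₂ : ℤ, 0 < g ∧ IsCoprime f₁ f₂ ∧
      e₁ = g * f₁ ∧ e₂ = g * f₂ := by
    have hg : 0 < Int.gcd e₁ e₂ := Int.gcd_pos_of_ne_zero_left _ he₁.ne'
    obtain ⟨f₁, f₂, h, h1, h2⟩ := Int.exists_gcd_one hg
    exact ⟨Int.gcd e₁ e₂, f₁, f₂, by exact_mod_cast hg, Int.isCoprime_iff_gcd_eq_one.2 h,
      by rw [mul_comm]; exact h1, by rw [mul_comm]; exact h2⟩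
  have hf₁ : 0 < f₁ := pos_of_mul_pos_right he₁ hg.le
  have hf₂ : 0 < f₂ := pos_of_mul_pos_right he₂ hg.le
  have hl : g * (f₁ * f₂) ∣ (N : ℤ) := by
    obtain ⟨t, ht⟩ := heN₁
    rw [ht, mul_assoc]
    refine mul_dvd_mul_left g (mul_dvd_mul_left f₁ ?_)
    rw [ht, mul_assoc] at heN₂
    exact hcop.symm.dvd_of_dvd_mul_left ((mul_dvd_mul_iff_left hg.ne').1 heN₂)
  obtain ⟨m, hm⟩ := hl
  rw [hm] at hdet₁ hdet₂ hγ₁ hγ₂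
  rw [MemGamma0Plus, hm]
  refine ⟨f₁ * f₂ * (g * p₁ * p₂ + b₁ * m * r₂), f₁ * p₁ * b₂ + b₁ * f₂ * s₂,
    g * (f₁ * f₂) * m * (r₁ * f₂ * p₂ + f₁ * s₁ * r₂),
    f₁ * f₂ * (m * r₁ * b₂ + g * s₁ * s₂), f₁ * f₂, mul_pos hf₁ hf₂, ?_,
    ⟨g * m, by ring⟩, dvd_mul_right _ _, dvd_mul_right _ _, dvd_mul_right _ _, ?_⟩
  · have hgg : g * g ≠ 0 := mul_ne_zero hg.ne' hg.ne'
    apply mul_left_cancel₀ hgg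
    linear_combination (g * f₂) * hdet₁ + (g * f₁ * p₁ * (g * f₁ * s₁) -
      b₁ * (g * (f₁ * f₂) * m * r₁)) * hdet₂
  · rw [Matrix.SpecialLinearGroup.coe_mul, hγ₁, hγ₂]
    have hgR : (0 : ℝ) < g := by exact_mod_cast hg
    have h1R : (0 : ℝ) < f₁ := by exact_mod_cast hf₁
    have h2R : (0 : ℝ) < f₂ := by exact_mod_cast hf₂
    have hs : √((g : ℝ) * f₁) * √((g : ℝ) * f₂) = g * √((f₁ : ℝ) * f₂) := by
      rw [← Real.sqrt_mul (by positivity), show (g : ℝ) * f₁ * (g * f₂) = g ^ 2 * (f₁ * f₂) by ring,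
        Real.sqrt_mul (by positivity), Real.sqrt_sq hgR.le]
    have hs' : (√((g : ℝ) * f₁))⁻¹ * (√((g : ℝ) * f₂))⁻¹ = (√((f₁ : ℝ) * f₂))⁻¹ * (g : ℝ)⁻¹ := by
      rw [← mul_inv, hs, mul_inv, mul_comm]
    push_cast
    rw [Matrix.smul_mul, Matrix.mul_smul, smul_smul, hs', ← smul_smul]
    congr 1
    ext i j
    fin_cases i <;> fin_cases j <;> simp <;> field_simp

/-- The group `Γ₀(N)⁺`. -/
def Gamma0Plus (N : ℕ) : Subgroup SL(2, ℝ) where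
  carrier := {γ | MemGamma0Plus N γ}
  one_mem' := memGamma0Plus_one N
  mul_mem' := memGamma0Plus_mul
  inv_mem' := memGamma0Plus_inv

/-- The surface `X_N = Γ₀(N)⁺ \ ℍ`, with the quotient topology. -/
abbrev X (N : ℕ) : Type := Quotient (MulAction.orbitRel (Gamma0Plus N) ℍ)

/-- The point of `X_N` represented by `z`. -/
def toX (N : ℕ) (z : ℍ) : X N := Quotient.mk _ z

/-- `X_N` has genus zero. For square-free `N` the surface has exactly one cusp, so its
compactification is its one-point compactification; genus zero means that this closed surface is
homeomorphic to the Riemann sphere. -/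
def HasGenusZero (N : ℕ) : Prop := Nonempty (OnePoint (X N) ≃ₜ OnePoint ℂ)

/-- `z` is fixed by some elliptic element of `Γ₀(N)⁺`. -/
def IsEllipticPoint (N : ℕ) (z : ℍ) : Prop :=
  ∃ γ ∈ Gamma0Plus N, (γ : Matrix (Fin 2) (Fin 2) ℝ).IsElliptic ∧ γ • z = z

/-- The order of the stabilizer of `z` in `Γ₀(N)⁺ / {± Id}`, the image of `Γ₀(N)⁺` in
`PSL(2, ℝ)`. -/
def ord (N : ℕ) (z : ℍ) : ℕ :=
  Nat.card ((Gamma0Plus N ⊓ MulAction.stabilizer SL(2, ℝ) z).map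
    (QuotientGroup.mk' (Subgroup.center SL(2, ℝ))))

/-- `j` is the Hauptmodul `j_N`: a holomorphic `Γ₀(N)⁺`-invariant function on `ℍ` with expansion
`q⁻¹ + ∑_{k ≥ 1} a_k q^k`, where `q = exp (2πiz)`. -/
structure IsHauptmodul (N : ℕ) (j : ℍ → ℂ) : Prop where
  holomorphic : MDifferentiable 𝓘(ℂ) 𝓘(ℂ) j
  invariant : ∀ γ ∈ Gamma0Plus N, ∀ z : ℍ, j (γ • z) = j z
  expansion : ∃ a : ℕ → ℂ, ∀ z : ℍ,
    HasSum (fun k : ℕ => a (k + 1) * Function.Periodic.qParam 1 z ^ (k + 1))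
      (j z - (Function.Periodic.qParam 1 z)⁻¹)

/-- The derivative `f'` with respect to the coordinate `z` of a function `f` on `ℍ`
(meaningful at points with positive imaginary part). -/
def derivH (f : ℍ → ℂ) : ℂ → ℂ := deriv (f ∘ UpperHalfPlane.ofComplex)

end GenusZero

end

noncomputable section

namespace GenusZero

open UpperHalfPlane Matrix
open scoped MatrixGroups Manifold
open Filter Topology Function.Periodic

/-! The heart is that `j` separates the points of `X N`. Let `B` be `multipleValues N j`, the set of
values shared by two inequivalent points. It is open, because `X N` is Hausdorff and `j` is an open
map, and it is bounded, because near the cusp `j` behaves like `q⁻¹` and is injective modulo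
translations.

At a point outside `B`, either a whole neighbourhood misses `B` or a punctured neighbourhood lies in
`B` (`eventually_not_mem_or_eventually_mem`). So the interior of the complement of `B` is closed as
well as open; it is nonempty by boundedness, hence all of `ℂ`, and `B` is empty.

Locally, `j` takes values near `j z` exactly `valueOrder j z` times near `z`, while the stabilizer
of `z` identifies nearby points in groups of `ord N z`. An excess of the first number over the
second would produce shared values, so the two agree (`valueOrder_eq_ord`). Differentiation lowers
the order by one, which gives all three parts. -/

/-! ### Discreteness and reduction theory of `Γ₀(N)⁺`. -/

theorem eq_one_of_memGamma0Plus {N : ℕ} (hN : N ≠ 0) {γ : SL(2, ℝ)} (h : MemGamma0Plus N γ)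
    (h01 : |γ 0 1| * √N < 1) (h10 : |γ 1 0| * √N < 1) (h00 : 0 < γ 0 0) : γ = 1 := by
  obtain ⟨a, b, c, d, e, he, hdet, heN, hea, hed, hNc, hγ⟩ := h
  have heR : (0 : ℝ) < e := by exact_mod_cast he
  have hs : 0 < √(e : ℝ) := Real.sqrt_pos.2 heR
  have heN' : √(e : ℝ) ≤ √N := by
    apply Real.sqrt_le_sqrt
    exact_mod_cast Int.le_of_dvd (by positivity) heN
  have key (x : ℤ) (y : ℝ) (hy : y = (√(e : ℝ))⁻¹ * x) (hlt : |y| * √N < 1) : x = 0 := by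
    have h1 : (x : ℝ) = y * √(e : ℝ) := by rw [hy]; field_simp
    have h2 : |(x : ℝ)| < 1 := by
      rw [h1, abs_mul, abs_of_pos hs]
      exact (mul_le_mul_of_nonneg_left heN' (abs_nonneg _)).trans_lt hlt
    exact Int.abs_lt_one_iff.1 (by exact_mod_cast h2)
  have e01 : γ 0 1 = (√(e : ℝ))⁻¹ * b := by
    have := congrFun₂ hγ 0 1; simpa using this
  have e10 : γ 1 0 = (√(e : ℝ))⁻¹ * c := by
    have := congrFun₂ hγ 1 0; simpa using this
  have e00 : γ 0 0 = (√(e : ℝ))⁻¹ * a := by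
    have := congrFun₂ hγ 0 0; simpa using this
  obtain rfl := key b _ e01 h01
  obtain rfl := key c _ e10 h10
  have ha : 0 < a := by
    rw [e00] at h00
    exact_mod_cast pos_of_mul_pos_right h00 (by positivity)
  obtain ⟨p, rfl⟩ := hea
  obtain ⟨s, rfl⟩ := hed
  have hps : e * (p * s) = 1 := by
    apply mul_left_cancel₀ he.ne'
    linear_combination hdet
  have he1 : e = 1 := Int.eq_one_of_mul_eq_one_right he.le hps
  subst he1
  simp only [one_mul] at hps ha
  have hp1 : p = 1 := Int.eq_one_of_mul_eq_one_right ha.le hps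
  subst hp1
  obtain rfl : s = 1 := by simpa using hps
  ext i j
  rw [hγ]
  fin_cases i <;> fin_cases j <;> simp

/-- Entries are integers divided by `√e` with `e ≤ N`, so bounding them isolates the identity.
Discreteness is what makes the action properly discontinuous, with finite stabilizers and Hausdorff
quotient. -/
theorem discreteTopology_gamma0Plus {N : ℕ} (hN : N ≠ 0) : DiscreteTopology (Gamma0Plus N) := by
  rw [discreteTopology_iff_isOpen_singleton_one]
  have hcont (i k : Fin 2) : Continuous fun γ : Gamma0Plus N => (γ : SL(2, ℝ)) i k := by fun_prop
  have : ({1} : Set (Gamma0Plus N)) = {γ : Gamma0Plus N | |(γ : SL(2, ℝ)) 0 1| * √N < 1} ∩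
      ({γ : Gamma0Plus N | |(γ : SL(2, ℝ)) 1 0| * √N < 1} ∩ {γ : Gamma0Plus N | 0 < (γ : SL(2, ℝ)) 0 0}) := by
    ext γ
    constructor
    · rintro rfl
      simp
    · rintro ⟨h1, h2, h3⟩
      exact Subtype.ext (eq_one_of_memGamma0Plus hN γ.2 h1 h2 h3)
  rw [this]
  exact (isOpen_lt ((hcont 0 1).abs.mul continuous_const) continuous_const).inter
    ((isOpen_lt ((hcont 1 0).abs.mul continuous_const) continuous_const).inter
      (isOpen_lt continuous_const (hcont 0 0)))

theorem exists_translation_mem (N : ℕ) (n : ℤ) :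
    ∃ γ ∈ Gamma0Plus N, ∀ z : ℍ, ((γ • z : ℍ) : ℂ) = z + n := by
  obtain ⟨γ, hγ⟩ : ∃ γ : SL(2, ℝ), (γ : Matrix (Fin 2) (Fin 2) ℝ) = !![1, (n : ℝ); 0, 1] :=
    ⟨⟨_, by simp⟩, rfl⟩
  refine ⟨γ, ⟨1, n, 0, 1, 1, by norm_num, by norm_num, one_dvd _,
    one_dvd _, one_dvd _, dvd_zero _, by simpa using hγ⟩, fun z => ?_⟩
  rw [coe_specialLinearGroup_apply, hγ]
  simp

/-- Take `e = N / gcd(c, N)`. Square-freeness makes `e` coprime to `c`, so `e * d` and `c` satisfy a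
Bézout relation, which supplies the top row. -/
theorem exists_mem_gamma0Plus_row {N : ℕ} (hN : Squarefree N) {c d : ℤ} (hcd : IsCoprime c d) :
    ∃ γ ∈ Gamma0Plus N, ∃ e : ℕ, 0 < e ∧ e ≤ N ∧ γ 1 0 = √(e : ℝ) * c ∧ γ 1 1 = √(e : ℝ) * d := by
  have hN0 : N ≠ 0 := hN.ne_zero
  set g : ℕ := Nat.gcd c.natAbs N with hg
  obtain ⟨e, he⟩ : g ∣ N := Nat.gcd_dvd_right _ _
  have hgc : (g : ℤ) ∣ c := Int.natCast_dvd.2 (Nat.gcd_dvd_left _ _)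
  have he0 : 0 < e := Nat.pos_of_ne_zero fun h => hN0 (by rw [he, h, mul_zero])
  have hec : IsCoprime (e : ℤ) c := by
    rw [Int.isCoprime_iff_gcd_eq_one, Int.gcd, Int.natAbs_natCast, ← Nat.coprime_iff_gcd_eq_one]
    refine Nat.coprime_of_dvd fun p hp hpe hpc => ?_
    have hpg : p ∣ g := Nat.dvd_gcd hpc (he ▸ hpe.mul_left g)
    exact hp.one_lt.ne' (Nat.isUnit_iff.1 (hN p (he ▸ mul_dvd_mul hpg hpe)))
  obtain ⟨u, v, huv⟩ : IsCoprime ((e : ℤ) * d) c := hec.mul_left hcd.symm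
  have heR : (0 : ℝ) < e := by exact_mod_cast he0
  have hs : √(e : ℝ) * √(e : ℝ) = e := Real.mul_self_sqrt heR.le
  have hs0 : √(e : ℝ) ≠ 0 := (Real.sqrt_pos.2 heR).ne'
  have huvR : (u : ℝ) * (e * d) + v * c = 1 := by exact_mod_cast huv
  refine ⟨⟨(√((e : ℤ) : ℝ))⁻¹ • !![((e * u : ℤ) : ℝ), ((-v : ℤ) : ℝ);
      ((e * c : ℤ) : ℝ), ((e * d : ℤ) : ℝ)], ?_⟩,
    ⟨e * u, -v, e * c, e * d, e, by exact_mod_cast he0, by linear_combination (e : ℤ) * huv,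
      by exact_mod_cast Dvd.intro_left g he.symm, dvd_mul_right _ _, dvd_mul_right _ _, ?_, rfl⟩,
      e, he0, ?_, ?_, ?_⟩
  · rw [Matrix.det_smul, Matrix.det_fin_two]
    push_cast
    simp
    field_simp
    linear_combination huvR
  · rw [he, mul_comm]
    push_cast
    exact mul_dvd_mul_left _ hgc
  · exact Nat.le_of_dvd (Nat.pos_of_ne_zero hN0) (Dvd.intro_left g he.symm)
  · simp
    field_simp
    linear_combination (-c : ℝ) * hs
  · simp
    field_simp
    linear_combination (-d : ℝ) * hs

theorem exists_mem_gamma0Plus_le_im {N : ℕ} (hN : Squarefree N) (z : ℍ) :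
    ∃ γ ∈ Gamma0Plus N, 1 / (2 * N : ℝ) ≤ (γ • z).im := by
  obtain ⟨A, hA⟩ := ModularGroup.exists_one_half_le_im_smul z
  have hcop : IsCoprime (A 1 0) (A 1 1) := by
    have := A.det_coe
    rw [Matrix.det_fin_two] at this
    exact ⟨-A 0 1, A 0 0, by linear_combination this⟩
  obtain ⟨γ, hγ, e, he0, heN, h10, h11⟩ := exists_mem_gamma0Plus_row hN hcop
  refine ⟨γ, hγ, ?_⟩
  have heR : (0 : ℝ) < e := by exact_mod_cast he0
  have heN' : (e : ℝ) ≤ N := by exact_mod_cast heN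
  have hsc : Complex.normSq (√(e : ℝ)) = e := by
    rw [Complex.normSq_ofReal, Real.mul_self_sqrt heR.le]
  -- The bottom row of `γ` is `√e` times that of `A`, so only a factor `e ≤ N` is lost against the
  -- bound for `SL(2, ℤ)`.
  have key : (γ • z).im = (A • z).im / e := by
    rw [MulAction.compHom_smul_def, MulAction.compHom_smul_def, im_smul_eq_div_normSq,
      im_smul_eq_div_normSq]
    have : denom (SpecialLinearGroup.mapGL ℝ γ) z =
        (√(e : ℝ) : ℂ) * denom (SpecialLinearGroup.mapGL ℝ A) z := by
      simp [denom, h10, h11]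
      ring
    rw [this, map_mul, hsc]
    simp [div_div, mul_comm]
  rw [key]
  calc 1 / (2 * N : ℝ) ≤ 1 / (2 * e) := by gcongr
    _ = (1 / 2) / e := by ring
    _ ≤ _ := by gcongr

theorem exists_mem_gamma0Plus_reduced {N : ℕ} (hN : Squarefree N) (z : ℍ) :
    ∃ γ ∈ Gamma0Plus N, 1 / (2 * N : ℝ) ≤ (γ • z).im ∧ |(γ • z).re| ≤ 1 := by
  obtain ⟨γ, hγ, him⟩ := exists_mem_gamma0Plus_le_im hN z
  obtain ⟨τ, hτ, h⟩ := exists_translation_mem N (-⌊(γ • z).re⌋)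
  refine ⟨τ * γ, mul_mem hτ hγ, ?_⟩
  have h1 := h (γ • z)
  rw [mul_smul]
  have him' := congrArg Complex.im h1
  have hre' := congrArg Complex.re h1
  simp at him' hre'
  rw [him', hre']
  refine ⟨him, ?_⟩
  rw [abs_le]
  have := Int.floor_le (γ • z).re
  have := Int.lt_floor_add_one (γ • z).re
  constructor <;> linarith

/-! ### Stabilizers and elliptic points. -/

theorem not_mem_center_mapGL {γ : SL(2, ℝ)} (h : γ ∉ Subgroup.center SL(2, ℝ)) :
    SpecialLinearGroup.mapGL ℝ γ ∉ Subgroup.center (GL (Fin 2) ℝ) := by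
  contrapose! h
  rw [Subgroup.mem_center_iff] at h ⊢
  intro g
  apply SpecialLinearGroup.mapGL_injective (S := ℝ)
  simpa using h (SpecialLinearGroup.mapGL ℝ g)

theorem smul_eq_of_mem_center {γ : SL(2, ℝ)} (h : γ ∈ Subgroup.center SL(2, ℝ)) (z : ℍ) :
    γ • z = z := by
  by_contra hz
  obtain ⟨r, hr, hγ⟩ := Matrix.SpecialLinearGroup.mem_center_iff.1 h
  apply hz
  ext
  rw [coe_specialLinearGroup_apply, ← hγ]
  have hr0 : (r : ℂ) ≠ 0 := by
    rintro h0
    simp [Complex.ofReal_eq_zero.1 h0] at hr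
  simp
  field_simp

theorem isElliptic_of_smul_eq {γ : SL(2, ℝ)} (h : γ ∉ Subgroup.center SL(2, ℝ)) {z : ℍ}
    (hz : γ • z = z) : (γ : Matrix (Fin 2) (Fin 2) ℝ).IsElliptic :=
  isElliptic_of_exists_smul_eq_self (g := SpecialLinearGroup.mapGL ℝ γ) (by simp)
    (not_mem_center_mapGL h) ⟨z, hz⟩

theorem not_mem_center_of_isElliptic {γ : SL(2, ℝ)}
    (h : (γ : Matrix (Fin 2) (Fin 2) ℝ).IsElliptic) : γ ∉ Subgroup.center SL(2, ℝ) := by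
  intro hc
  obtain ⟨r, hr, hγ⟩ := Matrix.SpecialLinearGroup.mem_center_iff.1 hc
  rw [← hγ, Matrix.IsElliptic, Matrix.discr_fin_two] at h
  simp at h
  nlinarith

theorem mem_center_of_smul_eq_of_ne {γ : SL(2, ℝ)} {z w : ℍ} (hzw : z ≠ w) (hz : γ • z = z)
    (hw : γ • w = w) : γ ∈ Subgroup.center SL(2, ℝ) := by
  by_contra h
  have hell : (SpecialLinearGroup.mapGL ℝ γ).IsElliptic := isElliptic_of_smul_eq h hz
  exact hzw (((gl_smul_eq_self_iff_eq_fixedPt (by simp) hell).1 hz).trans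
    ((gl_smul_eq_self_iff_eq_fixedPt (by simp) hell).1 hw).symm)

theorem ncard_image_eq_of_fibers {α β γ : Type*} {s : Set α} (f : α → β) (g : α → γ)
    (h : ∀ a ∈ s, ∀ b ∈ s, f a = f b ↔ g a = g b) : (f '' s).ncard = (g '' s).ncard := by
  choose p hp using fun y (hy : y ∈ f '' s) => hy
  refine Set.ncard_congr (fun y hy => g (p y hy)) (fun y hy => ⟨p y hy, (hp y hy).1, rfl⟩) ?_ ?_
  · intro y y' hy hy' hyy
    rw [← (hp y hy).2, ← (hp y' hy').2]
    exact (h _ (hp y hy).1 _ (hp y' hy').1).2 hyy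
  · rintro _ ⟨a, ha, rfl⟩
    have hfa : f a ∈ f '' s := ⟨a, ha, rfl⟩
    exact ⟨f a, hfa, (h _ (hp _ hfa).1 _ ha).1 (hp _ hfa).2⟩

theorem ord_eq_ncard_image (N : ℕ) (z : ℍ) :
    ord N z = (QuotientGroup.mk' (Subgroup.center SL(2, ℝ)) ''
      {γ | γ ∈ Gamma0Plus N ∧ γ • z = z}).ncard := by
  rw [← Nat.card_coe_set_eq]
  rfl

/-- A noncentral element fixes at most one point of `ℍ`, so the stabilizer modulo the centre acts
freely away from `z`. -/
theorem ord_eq_ncard_orbit (N : ℕ) {z w : ℍ} (hzw : w ≠ z) :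
    ord N z = ((fun γ : SL(2, ℝ) => γ • w) '' {γ | γ ∈ Gamma0Plus N ∧ γ • z = z}).ncard := by
  rw [ord_eq_ncard_image]
  apply ncard_image_eq_of_fibers
  rintro a ⟨-, ha⟩ b ⟨-, hb⟩
  rw [QuotientGroup.mk'_apply, QuotientGroup.mk'_apply, QuotientGroup.eq]
  constructor
  · intro h
    have := smul_eq_of_mem_center h w
    rwa [mul_smul, inv_smul_eq_iff, eq_comm] at this
  · intro h
    refine mem_center_of_smul_eq_of_ne hzw.symm ?_ ?_
    · rw [mul_smul, hb, inv_smul_eq_iff, ha]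
    · rw [mul_smul, inv_smul_eq_iff]
      exact h.symm

theorem finite_stabilizer_gamma0Plus {N : ℕ} (hN : N ≠ 0) (z : ℍ) :
    {γ : SL(2, ℝ) | γ ∈ Gamma0Plus N ∧ γ • z = z}.Finite := by
  have := discreteTopology_gamma0Plus hN
  refine ((ProperlyDiscontinuousSMul.finite_stabilizer' (Gamma0Plus N) z).image
    Subtype.val).subset ?_
  rintro γ ⟨h, h'⟩
  exact ⟨⟨γ, h⟩, h', rfl⟩

theorem ord_pos {N : ℕ} (hN : N ≠ 0) (z : ℍ) : 0 < ord N z := by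
  rw [ord_eq_ncard_image, Set.ncard_pos ((finite_stabilizer_gamma0Plus hN z).image _)]
  exact ⟨_, 1, ⟨one_mem _, one_smul _ _⟩, rfl⟩

theorem isEllipticPoint_iff {N : ℕ} (hN : N ≠ 0) (z : ℍ) : IsEllipticPoint N z ↔ 1 < ord N z := by
  rw [ord_eq_ncard_image, Set.one_lt_ncard_iff ((finite_stabilizer_gamma0Plus hN z).image _)]
  constructor
  · rintro ⟨γ, hγ, hell, hz⟩
    refine ⟨_, _, ⟨γ, ⟨hγ, hz⟩, rfl⟩, ⟨1, ⟨one_mem _, one_smul _ _⟩, rfl⟩, fun h => ?_⟩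
    rw [map_one, QuotientGroup.mk'_apply, QuotientGroup.eq_one_iff] at h
    exact not_mem_center_of_isElliptic hell h
  · rintro ⟨_, _, ⟨a, ⟨ha, haz⟩, rfl⟩, ⟨b, ⟨hb, hbz⟩, rfl⟩, hne⟩
    have hz : (a⁻¹ * b) • z = z := by rw [mul_smul, hbz, inv_smul_eq_iff, haz]
    refine ⟨a⁻¹ * b, mul_mem (inv_mem ha) hb, isElliptic_of_smul_eq (fun h => hne ?_) hz, hz⟩
    rwa [QuotientGroup.mk'_apply, QuotientGroup.mk'_apply, QuotientGroup.eq]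

theorem toX_eq_iff {N : ℕ} {z w : ℍ} : toX N z = toX N w ↔ ∃ γ ∈ Gamma0Plus N, γ • w = z := by
  rw [toX, toX, Quotient.eq, MulAction.orbitRel_apply, MulAction.mem_orbit_iff]
  exact ⟨fun ⟨γ, h⟩ => ⟨γ, γ.2, h⟩, fun ⟨γ, h, h'⟩ => ⟨⟨γ, h⟩, h'⟩⟩

/-! ### Local normal form and local fibres of analytic functions. -/

/-- Write `f = (z - z₀)^n g` and extract an `n`-th root of `g`. Dividing by `g z₀` first keeps the
base near `1`, where the principal power is analytic. -/
theorem exists_pow_eq_of_analyticOrderAt {f : ℂ → ℂ} {z₀ : ℂ} {n : ℕ} (hn : n ≠ 0)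
    (hf : AnalyticAt ℂ f z₀) (h : analyticOrderAt f z₀ = n) :
    ∃ φ : ℂ → ℂ, ∃ c : ℂ, c ≠ 0 ∧ HasStrictDerivAt φ c z₀ ∧ φ z₀ = 0 ∧
      ∀ᶠ z in 𝓝 z₀, f z = φ z ^ n := by
  obtain ⟨g, hg, hg0, hfg⟩ := hf.analyticOrderAt_eq_natCast.1 h
  obtain ⟨c, hc⟩ := IsAlgClosed.exists_pow_nat_eq (g z₀) (Nat.pos_of_ne_zero hn)
  have hc0 : c ≠ 0 := by
    rintro rfl
    exact hg0 (by rw [← hc, zero_pow hn])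
  have hψ : AnalyticAt ℂ (fun z => c * (g z / g z₀) ^ ((n : ℂ)⁻¹)) z₀ := by
    refine analyticAt_const.mul ((hg.div_const).cpow analyticAt_const ?_)
    simp [div_self hg0]
  have hφ : AnalyticAt ℂ (fun z => (z - z₀) * (c * (g z / g z₀) ^ ((n : ℂ)⁻¹))) z₀ :=
    (analyticAt_id.sub analyticAt_const).mul hψ
  refine ⟨fun z => (z - z₀) * (c * (g z / g z₀) ^ ((n : ℂ)⁻¹)), c, hc0, ?_, by simp, ?_⟩
  · have := HasStrictDerivAt.fun_mul ((hasStrictDerivAt_id z₀).sub_const z₀) hψ.hasStrictDerivAt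
    simpa [div_self hg0] using this
  · filter_upwards [hfg] with z hz
    rw [hz, mul_pow, mul_pow, hc, Complex.cpow_nat_inv_pow _ hn, smul_eq_mul,
      mul_div_cancel₀ _ hg0]

theorem exists_nhds_encard_fiber_le {f : ℂ → ℂ} {z₀ : ℂ} {n : ℕ} (hn : n ≠ 0)
    (hf : AnalyticAt ℂ f z₀) (h : analyticOrderAt (f · - f z₀) z₀ = n) :
    ∃ U ∈ 𝓝 z₀, (∀ w, {z ∈ U | f z = w}.encard ≤ n) ∧ ∀ z ∈ U, f z = f z₀ → z = z₀ := by
  obtain ⟨φ, c, hc, hφ, hφ0, hfφ⟩ :=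
    exists_pow_eq_of_analyticOrderAt hn (hf.sub analyticAt_const) h
  set U := {z | f z - f z₀ = φ z ^ n ∧ hφ.localInverse φ c z₀ hc (φ z) = z}
  have hU : U ∈ 𝓝 z₀ := hfφ.and (hφ.eventually_left_inverse hc)
  have key : Set.InjOn φ U := by
    intro x hx y hy hxy
    rw [← hx.2, ← hy.2, hxy]
  refine ⟨U, hU, fun w => ?_, fun z hz hzw => ?_⟩
  · rw [← (key.mono (Set.sep_subset U _)).encard_image]
    have : φ '' {z ∈ U | f z = w} ⊆ ((Polynomial.nthRoots n (w - f z₀)).toFinset : Set ℂ) := by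
      rintro _ ⟨z, ⟨hz, rfl⟩, rfl⟩
      rw [Finset.mem_coe, Multiset.mem_toFinset, Polynomial.mem_nthRoots (Nat.pos_of_ne_zero hn)]
      exact hz.1.symm
    refine (Set.encard_le_encard this).trans ?_
    rw [Set.encard_coe_eq_coe_finsetCard]
    exact Nat.cast_le.2 ((Multiset.toFinset_card_le _).trans (Polynomial.card_nthRoots n _))
  · refine key hz (mem_of_mem_nhds hU) ?_
    have := hz.1
    rw [hzw, sub_self, eq_comm, pow_eq_zero_iff hn] at this
    rw [this, hφ0]

theorem eventually_exists_fiber_card_eq {f : ℂ → ℂ} {z₀ : ℂ} {n : ℕ} (hn : n ≠ 0)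
    (hf : AnalyticAt ℂ f z₀) (h : analyticOrderAt (f · - f z₀) z₀ = n) {V : Set ℂ}
    (hV : V ∈ 𝓝 z₀) :
    ∀ᶠ w in 𝓝[≠] (f z₀), ∃ s : Finset ℂ, s.card = n ∧ ∀ z ∈ s, z ∈ V ∧ f z = w := by
  obtain ⟨φ, c, hc, hφ, hφ0, hfφ⟩ :=
    exists_pow_eq_of_analyticOrderAt hn (hf.sub analyticAt_const) h
  have himg : φ '' (V ∩ {z | f z - f z₀ = φ z ^ n}) ∈ 𝓝 (0 : ℂ) := by
    rw [← hφ0, ← hφ.map_nhds_eq hc]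
    exact image_mem_map (inter_mem hV hfφ)
  obtain ⟨r, hr, hball⟩ := Metric.mem_nhds_iff.1 himg
  have hrn : 0 < r ^ n := pow_pos hr n
  rw [eventually_nhdsWithin_iff]
  -- Radius `r ^ n` puts every `n`-th root of `w - f z₀` in the ball of radius `r` covered by `φ`.
  filter_upwards [Metric.ball_mem_nhds (f z₀) hrn] with w hw hne
  rw [Metric.mem_ball, dist_eq_norm] at hw
  have hw0 : w - f z₀ ≠ 0 := sub_ne_zero.2 hne
  have hprim := Complex.isPrimitiveRoot_exp n hn
  have hroot (ζ : ℂ) (hζ : ζ ^ n = w - f z₀) : ∃ z, z ∈ V ∧ f z = w ∧ φ z = ζ := by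
    have : ζ ∈ Metric.ball (0 : ℂ) r := by
      rw [mem_ball_zero_iff]
      refine lt_of_pow_lt_pow_left₀ n hr.le ?_
      rwa [← norm_pow, hζ]
    obtain ⟨z, ⟨hz, hz'⟩, rfl⟩ := hball this
    refine ⟨z, hz, ?_, rfl⟩
    have : f z - f z₀ = φ z ^ n := hz'
    rw [hζ] at this
    exact sub_left_injective this
  choose! ψ hψ using hroot
  have hnr : (Polynomial.nthRoots n (w - f z₀)).toFinset.card = n := by
    rw [Multiset.toFinset_card_of_nodup (hprim.nthRoots_nodup hw0), hprim.card_nthRoots,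
      if_pos (IsAlgClosed.exists_pow_nat_eq _ (Nat.pos_of_ne_zero hn))]
  have hmem {ζ : ℂ} (hζ : ζ ∈ (Polynomial.nthRoots n (w - f z₀)).toFinset) :
      ζ ^ n = w - f z₀ := by
    rwa [Multiset.mem_toFinset, Polynomial.mem_nthRoots (Nat.pos_of_ne_zero hn)] at hζ
  refine ⟨(Polynomial.nthRoots n (w - f z₀)).toFinset.image ψ, ?_, ?_⟩
  · rw [Finset.card_image_of_injOn, hnr]
    intro x hx y hy hxy
    rw [← (hψ x (hmem hx)).2.2, ← (hψ y (hmem hy)).2.2, hxy]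
  · intro z hz
    obtain ⟨ζ, hζ, rfl⟩ := Finset.mem_image.1 hz
    exact ⟨(hψ ζ (hmem hζ)).1, (hψ ζ (hmem hζ)).2.1⟩

/-! ### Behaviour of the Hauptmodul at the cusp. -/

theorem exists_analyticAt_of_hasSum {a : ℕ → ℂ} {f : ℂ → ℂ} {q₀ : ℂ} (hq₀ : q₀ ≠ 0) {s : Set ℂ}
    (hs : q₀ ∈ s) (h : ∀ q ∈ s, HasSum (fun k : ℕ => a (k + 1) * q ^ (k + 1)) (f q)) :
    ∃ G : ℂ → ℂ, AnalyticAt ℂ G 0 ∧ ∀ q ∈ s, f q = G q := by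
  set b : ℕ → ℂ := fun k => if k = 0 then 0 else a k with hb
  have hsum (q : ℂ) (hq : q ∈ s) : HasSum (fun k => b k * q ^ k) (f q) := by
    rw [← hasSum_nat_add_iff' 1]
    simpa [hb] using h q hq
  set p := FormalMultilinearSeries.ofScalars ℂ b with hp
  have hterm (q : ℂ) (k : ℕ) : p k (fun _ => q) = b k * q ^ k := by
    rw [hp, FormalMultilinearSeries.ofScalars_apply_eq, smul_eq_mul]
  have hrad : 0 < p.radius := by
    refine lt_of_lt_of_le ?_ (p.le_radius_of_tendsto (r := ‖q₀‖₊) (l := 0) ?_)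
    · simpa using hq₀
    · have := (hsum q₀ hs).summable.tendsto_atTop_zero.norm
      simpa [hp] using this
  refine ⟨p.sum, (p.hasFPowerSeriesOnBall hrad).analyticAt, fun q hq => ?_⟩
  rw [FormalMultilinearSeries.sum]
  simp_rw [hterm]
  exact (hsum q hq).tsum_eq.symm

theorem IsHauptmodul.exists_eq_inv_add {N : ℕ} {j : ℍ → ℂ} (hj : IsHauptmodul N j) :
    ∃ G : ℂ → ℂ, AnalyticAt ℂ G 0 ∧ ∀ z : ℍ, j z = (qParam 1 z)⁻¹ + G (qParam 1 z) := by
  obtain ⟨a, ha⟩ := hj.expansion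
  have hfac (z w : ℍ) (h : qParam 1 z = qParam 1 w) : j z = j w := by
    have h1 := ha z
    rw [h] at h1
    exact sub_left_injective (h1.unique (ha w))
  obtain ⟨G, hG, hjG⟩ := exists_analyticAt_of_hasSum (a := a)
    (f := fun q => ∑' k : ℕ, a (k + 1) * q ^ (k + 1)) (s := Set.range fun z : ℍ => qParam 1 z)
    (qParam_ne_zero (h := 1) (UpperHalfPlane.I : ℍ)) ⟨UpperHalfPlane.I, rfl⟩ (by
      rintro _ ⟨z, rfl⟩
      exact (ha z).summable.hasSum)
  refine ⟨G, hG, fun z => ?_⟩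
  rw [← hjG _ ⟨z, rfl⟩, (ha z).tsum_eq]
  ring

theorem eventually_qParam {P : ℂ → Prop} (h : ∀ᶠ q in 𝓝[≠] (0 : ℂ), P q) :
    ∃ Y : ℝ, ∀ z : ℍ, Y < z.im → P (qParam 1 z) := by
  obtain ⟨Y, -, hY⟩ := ((atTop_basis_Ioi.comap Complex.im).eventually_iff).1
    ((qParam_tendsto one_pos).eventually h)
  exact ⟨Y, fun z hz => hY hz⟩

theorem IsHauptmodul.exists_lt_norm {N : ℕ} {j : ℍ → ℂ} (hj : IsHauptmodul N j) (M : ℝ) :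
    ∃ Y : ℝ, ∀ z : ℍ, Y < z.im → M < ‖j z‖ := by
  obtain ⟨G, hG, hjG⟩ := hj.exists_eq_inv_add
  simp_rw [hjG]
  apply eventually_qParam (P := fun q => M < ‖q⁻¹ + G q‖)
  have hGb : ∀ᶠ q in 𝓝[≠] (0 : ℂ), ‖G q‖ < ‖G 0‖ + 1 :=
    nhdsWithin_le_nhds (hG.continuousAt.norm.eventually_lt_const (lt_add_one _))
  filter_upwards [hGb, tendsto_norm_inv_nhdsNE_zero_atTop.eventually_gt_atTop (M + (‖G 0‖ + 1))]
    with q h1 h2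
  have := norm_sub_le_norm_add q⁻¹ (G q)
  linarith

theorem exists_int_of_qParam_eq {z w : ℂ} (h : qParam 1 z = qParam 1 w) : ∃ n : ℤ, z = w + n := by
  obtain ⟨m, hm⟩ := qParam_left_inv_mod_period one_ne_zero z
  obtain ⟨k, hk⟩ := qParam_left_inv_mod_period one_ne_zero w
  refine ⟨k - m, ?_⟩
  rw [h, hk] at hm
  push_cast at hm ⊢
  linear_combination -hm

/-- In the coordinate `q`, `1 / j = q / (1 + q G(q))` has derivative `1` at `q = 0`, so it is
injective there, and `q` determines `z` modulo `ℤ`. -/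
theorem IsHauptmodul.exists_injective_mod_int {N : ℕ} {j : ℍ → ℂ} (hj : IsHauptmodul N j) :
    ∃ Y : ℝ, ∀ z w : ℍ, Y < z.im → Y < w.im → j z = j w → ∃ n : ℤ, (z : ℂ) = w + n := by
  obtain ⟨G, hG, hjG⟩ := hj.exists_eq_inv_add
  have hden : AnalyticAt ℂ (fun q => 1 + q * G q) 0 :=
    analyticAt_const.add (analyticAt_id.mul hG)
  have hderiv : HasStrictDerivAt (fun q => q / (1 + q * G q)) 1 0 := by
    simpa using HasStrictDerivAt.fun_div (hasStrictDerivAt_id (0 : ℂ)) hden.hasStrictDerivAt (by simp)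
  obtain ⟨Y, hY⟩ := eventually_qParam (P := fun q =>
    hderiv.localInverse _ 1 0 one_ne_zero (q / (1 + q * G q)) = q)
    (nhdsWithin_le_nhds (hderiv.eventually_left_inverse one_ne_zero))
  refine ⟨Y, fun z w hz hw hzw => exists_int_of_qParam_eq ?_⟩
  have key (z : ℍ) : qParam 1 z / (1 + qParam 1 z * G (qParam 1 z)) = (j z)⁻¹ := by
    have := qParam_ne_zero (h := 1) (z : ℂ)
    rw [hjG, ← _root_.inv_inj, inv_inv, inv_div, add_div, mul_div_cancel_left₀ _ this, one_div]
  rw [← hY z hz, ← hY w hw, key, key, hzw]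

/-! ### Multiplicities of the Hauptmodul on `ℍ`. -/

section Hauptmodul

variable {N : ℕ} {j : ℍ → ℂ}

theorem IsHauptmodul.analyticOnNhd (hj : IsHauptmodul N j) :
    AnalyticOnNhd ℂ (j ∘ ofComplex) {z | 0 < z.im} :=
  (UpperHalfPlane.mdifferentiable_iff.1 hj.holomorphic).analyticOnNhd isOpen_upperHalfPlaneSet

theorem IsHauptmodul.analyticAt (hj : IsHauptmodul N j) (z : ℍ) :
    AnalyticAt ℂ (j ∘ ofComplex) (z : ℂ) :=
  hj.analyticOnNhd z z.im_pos

theorem IsHauptmodul.continuous (hj : IsHauptmodul N j) : Continuous j :=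
  hj.holomorphic.continuous

theorem exists_lt_im (Y : ℝ) : ∃ z : ℍ, Y < z.im :=
  ⟨⟨⟨0, |Y| + 1⟩, by positivity⟩, (le_abs_self Y).trans_lt (lt_add_one _)⟩

/-- The order at `z` of a Hauptmodul minus its value at `z`. -/
def valueOrder (j : ℍ → ℂ) (z : ℍ) : ℕ :=
  analyticOrderNatAt ((j ∘ ofComplex) · - j z) (z : ℂ)

theorem IsHauptmodul.valueOrder_eq (hj : IsHauptmodul N j) (z : ℍ) :
    analyticOrderAt (fun w => (j ∘ ofComplex) w - (j ∘ ofComplex) z) (z : ℂ) = valueOrder j z := by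
  rw [valueOrder, Nat.cast_analyticOrderNatAt, Function.comp_apply, ofComplex_apply]
  -- Infinite order would make `j` constant, contradicting its pole at the cusp; so the `ℕ`-valued
  -- order loses nothing.
  intro htop
  have hconst : ∀ w : ℍ, j w = j z := by
    have heq := hj.analyticOnNhd.eqOn_of_preconnected_of_eventuallyEq
      (analyticOnNhd_const (v := j z)) (convex_halfSpace_im_gt 0).isPreconnected z.im_pos
      ((analyticOrderAt_eq_top.1 htop).mono fun w hw => sub_eq_zero.1 hw)
    intro w
    simpa using heq w.im_pos
  obtain ⟨Y, hY⟩ := hj.exists_lt_norm ‖j z‖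
  obtain ⟨w, hw⟩ := exists_lt_im Y
  exact (hY w hw).ne (by rw [hconst w])

theorem IsHauptmodul.valueOrder_ne_zero (hj : IsHauptmodul N j) (z : ℍ) : valueOrder j z ≠ 0 := by
  intro h
  have h1 := hj.valueOrder_eq z
  rw [h, Nat.cast_zero] at h1
  exact (AnalyticAt.analyticOrderAt_eq_zero
    ((hj.analyticAt z).fun_sub analyticAt_const)).1 h1 (sub_self _)

theorem IsHauptmodul.derivH_order (hj : IsHauptmodul N j) (z : ℍ) :
    analyticOrderAt (derivH j) (z : ℂ) + 1 = valueOrder j z := by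
  rw [derivH, (hj.analyticAt z).analyticOrderAt_deriv_add_one]
  exact hj.valueOrder_eq z

theorem coe_preimage_mem_nhds {z : ℍ} {U : Set ℂ} (hU : U ∈ 𝓝 (z : ℂ)) :
    (fun w : ℍ => (w : ℂ)) ⁻¹' U ∈ 𝓝 z :=
  continuous_coe.continuousAt hU

theorem IsHauptmodul.exists_nhds_fiber (hj : IsHauptmodul N j) (z : ℍ) :
    ∃ U ∈ 𝓝 z, (∀ w, {x ∈ U | j x = w}.encard ≤ valueOrder j z) ∧
      ∀ x ∈ U, j x = j z → x = z := by
  obtain ⟨U, hU, h1, h2⟩ := exists_nhds_encard_fiber_le (hj.valueOrder_ne_zero z)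
    (hj.analyticAt z) (hj.valueOrder_eq z)
  refine ⟨_, coe_preimage_mem_nhds hU, fun w => ?_, fun x hx hxz => ?_⟩
  · refine le_trans ?_ (h1 w)
    rw [← (UpperHalfPlane.coe_injective.injOn).encard_image]
    apply Set.encard_le_encard
    rintro _ ⟨x, ⟨hx, rfl⟩, rfl⟩
    exact ⟨hx, by simp⟩
  · exact UpperHalfPlane.ext (h2 x hx (by simpa using hxz))

theorem IsHauptmodul.eventually_fiber (hj : IsHauptmodul N j) (z : ℍ) {V : Set ℍ}
    (hV : V ∈ 𝓝 z) :
    ∀ᶠ w in 𝓝[≠] (j z), ∃ s : Finset ℍ, s.card = valueOrder j z ∧ ∀ x ∈ s, x ∈ V ∧ j x = w := by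
  have hV' : (fun w : ℍ => (w : ℂ)) '' V ∈ 𝓝 (z : ℂ) :=
    isOpenEmbedding_coe.isOpenMap.image_mem_nhds hV
  have := eventually_exists_fiber_card_eq (hj.valueOrder_ne_zero z)
    (hj.analyticAt z) (hj.valueOrder_eq z) hV'
  rw [Function.comp_apply, ofComplex_apply] at this
  classical
  filter_upwards [this] with w ⟨s, hs, h⟩
  refine ⟨s.image ofComplex, ?_, ?_⟩
  · rw [Finset.card_image_of_injOn, hs]
    intro x hx y hy hxy
    obtain ⟨⟨a, -, rfl⟩, -⟩ := h x hx
    obtain ⟨⟨b, -, rfl⟩, -⟩ := h y hy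
    simpa using hxy
  · intro x hx
    obtain ⟨y, hy, rfl⟩ := Finset.mem_image.1 hx
    obtain ⟨⟨a, ha, rfl⟩, h2⟩ := h y hy
    exact ⟨by simpa using ha, h2⟩

theorem IsHauptmodul.isOpenMap (hj : IsHauptmodul N j) : IsOpenMap j := by
  rw [isOpenMap_iff_nhds_le]
  intro z V hV
  have h := eventually_nhdsWithin_iff.1 (hj.eventually_fiber z (mem_map.1 hV))
  filter_upwards [h] with w hw
  by_cases hwz : w = j z
  · rw [hwz]
    exact mem_of_mem_nhds (s := j ⁻¹' V) (mem_map.1 hV)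
  · obtain ⟨s, hs, h'⟩ := hw hwz
    obtain ⟨x, hx⟩ := Finset.card_pos.1 (hs ▸ Nat.pos_of_ne_zero (hj.valueOrder_ne_zero z))
    obtain ⟨hxV, rfl⟩ := h' x hx
    exact hxV

end Hauptmodul

/-! ### Injectivity on the quotient and comparison of multiplicity with `ord`. -/

section Quotient

variable {N : ℕ} {j : ℍ → ℂ}

theorem exists_nhds_stabilizer_smul_mem {N : ℕ} (hN : N ≠ 0) {z : ℍ} {U : Set ℍ} (hU : U ∈ 𝓝 z) :
    ∃ V ∈ 𝓝 z, ∀ γ ∈ Gamma0Plus N, γ • z = z → ∀ x ∈ V, γ • x ∈ U := by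
  have h : ∀ᶠ x in 𝓝 z, ∀ γ ∈ {γ : SL(2, ℝ) | γ ∈ Gamma0Plus N ∧ γ • z = z}, γ • x ∈ U := by
    rw [eventually_all_finite (finite_stabilizer_gamma0Plus hN z)]
    rintro γ ⟨-, hγ⟩
    exact (continuous_const_smul γ).continuousAt.eventually (by simp only [hγ]; exact hU)
  exact ⟨_, h, fun γ hγ hz x hx => hx γ ⟨hγ, hz⟩⟩

/-- The values taken by `j` at two inequivalent points. -/
def multipleValues (N : ℕ) (j : ℍ → ℂ) : Set ℂ :=
  {w | ∃ x y : ℍ, toX N x ≠ toX N y ∧ j x = w ∧ j y = w}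

/-- The stabilizer orbit of a nearby `x ≠ z` lies in a local fibre with at most `valueOrder j z`
points. In case of equality the orbit is the whole local fibre, so equal values come from equivalent
points. -/
theorem IsHauptmodul.ord_le_valueOrder (hN : N ≠ 0) (hj : IsHauptmodul N j) (z : ℍ) :
    ord N z ≤ valueOrder j z ∧ (valueOrder j z ≤ ord N z →
      ∃ V ∈ 𝓝 z, ∀ x ∈ V, ∀ y ∈ V, j x = j y → toX N x = toX N y) := by
  obtain ⟨U, hU, hcard, huniq⟩ := hj.exists_nhds_fiber z
  obtain ⟨V, hV, hVU⟩ := exists_nhds_stabilizer_smul_mem hN hU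
  have horbit {x : ℍ} (hx : x ∈ V) :
      (fun γ : SL(2, ℝ) => γ • x) '' {γ | γ ∈ Gamma0Plus N ∧ γ • z = z} ⊆ {y ∈ U | j y = j x} := by
    rintro _ ⟨γ, ⟨hγ, hz⟩, rfl⟩
    exact ⟨hVU γ hγ hz x hx, hj.invariant γ hγ x⟩
  have hfin (w : ℂ) : {x ∈ U | j x = w}.Finite :=
    Set.finite_of_encard_le_coe (hcard w)
  have hncard (w : ℂ) : {x ∈ U | j x = w}.ncard ≤ valueOrder j z := by
    rw [← Nat.cast_le (α := ℕ∞), (hfin w).cast_ncard_eq]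
    exact hcard w
  refine ⟨?_, fun hle => ⟨V, hV, fun x hx y hy hxy => ?_⟩⟩
  · obtain ⟨w, ⟨s, hs, hsV⟩, hw⟩ := ((hj.eventually_fiber z hV).and self_mem_nhdsWithin).exists
    obtain ⟨x, hx⟩ := Finset.card_pos.1 (hs ▸ Nat.pos_of_ne_zero (hj.valueOrder_ne_zero z))
    obtain ⟨hxV, rfl⟩ := hsV x hx
    have hxz : x ≠ z := by
      rintro rfl
      exact hw rfl
    rw [ord_eq_ncard_orbit N hxz]
    exact (Set.ncard_le_ncard (horbit hxV) (hfin _)).trans (hncard _)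
  · have hVU' {x : ℍ} (hx : x ∈ V) : x ∈ U := by
      simpa using hVU 1 (one_mem _) (one_smul _ _) x hx
    by_cases hxz : x = z
    · rw [hxz, huniq y (hVU' hy) (by rw [← hxy, hxz])]
    by_cases hyz : y = z
    · rw [hyz, huniq x (hVU' hx) (by rw [hxy, hyz])]
    have hx' := Set.eq_of_subset_of_ncard_le (horbit hx)
      (by rw [← ord_eq_ncard_orbit N hxz]; exact (hncard _).trans hle) (hfin _)
    have hy' : y ∈ {y ∈ U | j y = j x} := ⟨hVU' hy, hxy.symm⟩
    rw [← hx'] at hy'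
    obtain ⟨γ, ⟨hγ, -⟩, h⟩ := hy'
    exact (toX_eq_iff.2 ⟨γ, hγ, h⟩).symm

/-- By proper discontinuity, equivalent points of `W` differ by an element of the stabilizer, so a
single class has at most `ord N z` points there: too few for a local fibre. -/
theorem IsHauptmodul.eventually_mem_multipleValues (hN : N ≠ 0) (hj : IsHauptmodul N j) {z : ℍ}
    (h : ord N z < valueOrder j z) : ∀ᶠ w in 𝓝[≠] (j z), w ∈ multipleValues N j := by
  have := discreteTopology_gamma0Plus hN
  obtain ⟨W, hW, hWz⟩ :=
    ProperlyDiscontinuousSMul.exists_nhds_image_smul_eq_self (Gamma0Plus N) z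
  filter_upwards [hj.eventually_fiber z hW, self_mem_nhdsWithin] with w ⟨s, hs, hsW⟩ hw
  obtain ⟨x, hx⟩ := Finset.card_pos.1 (hs ▸ Nat.pos_of_ne_zero (hj.valueOrder_ne_zero z))
  have hxz : x ≠ z := by
    rintro rfl
    exact hw (hsW x hx).2.symm
  by_contra hmem
  have hsub : (s : Set ℍ) ⊆
      (fun γ : SL(2, ℝ) => γ • x) '' {γ | γ ∈ Gamma0Plus N ∧ γ • z = z} := by
    intro y hy
    have heq : toX N y = toX N x := by
      by_contra hne
      exact hmem ⟨y, x, hne, (hsW y hy).2, (hsW x hx).2⟩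
    obtain ⟨γ, hγ, hγy⟩ := toX_eq_iff.1 heq
    exact ⟨γ, ⟨hγ, hWz ⟨γ, hγ⟩ ⟨y, ⟨x, (hsW x hx).1, hγy⟩, (hsW y hy).1⟩⟩, hγy⟩
  have := Set.ncard_le_ncard hsub ((finite_stabilizer_gamma0Plus hN z).image _)
  rw [Set.ncard_coe_finset, hs, ← ord_eq_ncard_orbit N hxz] at this
  omega

theorem isOpenMap_toX (N : ℕ) : IsOpenMap (toX N) :=
  isOpenMap_quotient_mk'_mul

theorem continuous_toX (N : ℕ) : Continuous (toX N) := continuous_quot_mk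

theorem IsHauptmodul.isOpen_multipleValues (hN : N ≠ 0) (hj : IsHauptmodul N j) :
    IsOpen (multipleValues N j) := by
  have := discreteTopology_gamma0Plus hN
  rw [isOpen_iff_mem_nhds]
  rintro w ⟨x, y, hne, rfl, hy⟩
  obtain ⟨A, B, hA, hB, hxA, hyB, hAB⟩ := t2_separation hne
  have h1 := (hj.isOpenMap _ (hA.preimage (continuous_toX N))).mem_nhds ⟨x, hxA, rfl⟩
  have h2 := (hj.isOpenMap _ (hB.preimage (continuous_toX N))).mem_nhds ⟨y, hyB, rfl⟩
  rw [hy] at h2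
  filter_upwards [h1, h2]
  rintro _ ⟨x', hx', rfl⟩ ⟨y', hy', h⟩
  exact ⟨x', y', fun h' => Set.disjoint_left.1 hAB hx' (h' ▸ hy'), rfl, h⟩

theorem isCompact_rectangle {c : ℝ} (hc : 0 < c) (Y : ℝ) :
    IsCompact {z : ℍ | |z.re| ≤ 1 ∧ c ≤ z.im ∧ z.im ≤ Y} := by
  rw [isOpenEmbedding_coe.isInducing.isCompact_iff]
  have : (fun z : ℍ => (z : ℂ)) '' {z : ℍ | |z.re| ≤ 1 ∧ c ≤ z.im ∧ z.im ≤ Y} =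
      Set.Icc (-1) 1 ×ℂ Set.Icc c Y := by
    ext z
    rw [Complex.mem_reProdIm]
    constructor
    · rintro ⟨z, ⟨h1, h2, h3⟩, rfl⟩
      exact ⟨abs_le.1 h1, h2, h3⟩
    · rintro ⟨h1, h2, h3⟩
      exact ⟨⟨z, hc.trans_le h2⟩, ⟨abs_le.2 h1, h2, h3⟩, rfl⟩
  rw [this]
  exact isCompact_Icc.reProdIm isCompact_Icc

/-- Properness of `j` on the quotient: bounded values keep reduced representatives away from the
cusp. -/
theorem IsHauptmodul.exists_isCompact (hN : Squarefree N) (hj : IsHauptmodul N j) (M : ℝ) :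
    ∃ K : Set ℍ, IsCompact K ∧ ∀ z, ‖j z‖ ≤ M → ∃ x ∈ K, toX N z = toX N x := by
  obtain ⟨Y, hY⟩ := hj.exists_lt_norm M
  have hN0 : (0 : ℝ) < N := by exact_mod_cast Nat.pos_of_ne_zero hN.ne_zero
  refine ⟨_, isCompact_rectangle (c := 1 / (2 * N)) (by positivity) Y, fun z hz => ?_⟩
  obtain ⟨γ, hγ, him, hre⟩ := exists_mem_gamma0Plus_reduced hN z
  refine ⟨γ • z, ⟨hre, him, ?_⟩, (toX_eq_iff.2 ⟨γ, hγ, rfl⟩).symm⟩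
  by_contra! h
  exact absurd (hY _ h) (by rw [hj.invariant γ hγ]; exact hz.not_gt)

theorem IsHauptmodul.exists_bound_multipleValues (hN : Squarefree N) (hj : IsHauptmodul N j) :
    ∃ M : ℝ, ∀ w ∈ multipleValues N j, ‖w‖ ≤ M := by
  obtain ⟨Y, hY⟩ := hj.exists_injective_mod_int
  have hN0 : (0 : ℝ) < N := by exact_mod_cast Nat.pos_of_ne_zero hN.ne_zero
  obtain ⟨M, hM⟩ := ((isCompact_rectangle (c := 1 / (2 * N)) (by positivity) Y).image
    hj.continuous).isBounded.exists_norm_le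
  refine ⟨M, ?_⟩
  rintro w ⟨x, y, hne, rfl, hy⟩
  by_contra! hlt
  have key (z : ℍ) (hz : M < ‖j z‖) : ∃ γ ∈ Gamma0Plus N, Y < (γ • z).im := by
    obtain ⟨γ, hγ, him, hre⟩ := exists_mem_gamma0Plus_reduced hN z
    refine ⟨γ, hγ, ?_⟩
    by_contra! h
    have := hM _ ⟨γ • z, ⟨hre, him, h⟩, rfl⟩
    rw [hj.invariant γ hγ] at this
    exact this.not_gt hz
  obtain ⟨α, hα, hαx⟩ := key x hlt
  obtain ⟨β, hβ, hβy⟩ := key y (by rwa [hy])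
  obtain ⟨n, hn⟩ := hY _ _ hαx hβy (by rw [hj.invariant α hα, hj.invariant β hβ, hy])
  obtain ⟨τ, hτ, h⟩ := exists_translation_mem N n
  have : α • x = τ • β • y := UpperHalfPlane.ext (by rw [hn, h])
  refine hne (toX_eq_iff.2 ⟨α⁻¹ * (τ * β), mul_mem (inv_mem hα) (mul_mem hτ hβ), ?_⟩)
  rw [mul_smul, mul_smul, ← this, inv_smul_smul]

theorem IsHauptmodul.eventually_not_mem_or_eventually_mem (hN : Squarefree N)
    (hj : IsHauptmodul N j) {w₀ : ℂ} (hw₀ : w₀ ∉ multipleValues N j) :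
    (∀ᶠ w in 𝓝 w₀, w ∉ multipleValues N j) ∨ ∀ᶠ w in 𝓝[≠] w₀, w ∈ multipleValues N j := by
  by_cases hlt : ∃ z, j z = w₀ ∧ ord N z < valueOrder j z
  · obtain ⟨z, rfl, hz⟩ := hlt
    exact Or.inr (hj.eventually_mem_multipleValues hN.ne_zero hz)
  left
  push Not at hlt
  obtain ⟨V, hVo, hV, hVinj⟩ : ∃ V : Set ℍ, IsOpen V ∧
      (∀ z, j z = w₀ → toX N z ∈ toX N '' V) ∧
      ∀ x ∈ V, ∀ y ∈ V, j x = j y → toX N x = toX N y := by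
    by_cases hex : ∃ z, j z = w₀
    · obtain ⟨z, hz⟩ := hex
      obtain ⟨V, hV, hinj⟩ := (hj.ord_le_valueOrder hN.ne_zero z).2 (hlt z hz)
      obtain ⟨V', hV', ho, hzV'⟩ := mem_nhds_iff.1 hV
      refine ⟨V', ho, fun y hy => ⟨z, hzV', ?_⟩,
        fun x hx y hy => hinj x (hV' hx) y (hV' hy)⟩
      by_contra hne
      exact hw₀ ⟨z, y, hne, hz, hy⟩
    · push Not at hex
      exact ⟨∅, isOpen_empty, fun z hz => absurd hz (hex z), by simp⟩
  obtain ⟨K, hK, hKj⟩ := hj.exists_isCompact hN (‖w₀‖ + 1)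
  set A : Set ℍ := toX N ⁻¹' (toX N '' V)
  have hA : IsOpen A := (isOpenMap_toX N V hVo).preimage (continuous_toX N)
  -- Values close to `w₀` avoid this closed set, so all their preimages are equivalent to points of
  -- `V`, where `j` is injective modulo the group.
  have hC : IsClosed (j '' (K \ A)) := ((hK.diff hA).image hj.continuous).isClosed
  have hw₀C : w₀ ∉ j '' (K \ A) := by
    rintro ⟨z, ⟨-, hzA⟩, hz⟩
    exact hzA (hV z hz)
  filter_upwards [hC.isOpen_compl.mem_nhds hw₀C,
    continuous_norm.continuousAt.eventually_lt_const (lt_add_one ‖w₀‖)] with w hwC hw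
  rintro ⟨x, y, hne, hx, hy⟩
  have key (z : ℍ) (hz : j z = w) : ∃ v ∈ V, toX N z = toX N v ∧ j v = w := by
    obtain ⟨k, hkK, hk⟩ := hKj z (by rw [hz]; exact hw.le)
    have hjeq {a b : ℍ} (hab : toX N a = toX N b) : j a = j b := by
      obtain ⟨γ, hγ, rfl⟩ := toX_eq_iff.1 hab
      exact hj.invariant γ hγ b
    have hkA : k ∈ A := by
      by_contra hkA
      exact hwC ⟨k, ⟨hkK, hkA⟩, by rw [← hjeq hk, hz]⟩
    obtain ⟨v, hv, hvk⟩ := hkA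
    exact ⟨v, hv, hk.trans hvk.symm, by rw [hjeq hvk, ← hjeq hk, hz]⟩
  obtain ⟨a, haV, hxa, ha⟩ := key x hx
  obtain ⟨b, hbV, hyb, hb⟩ := key y hy
  exact hne (hxa.trans ((hVinj a haV b hbV (ha.trans hb.symm)).trans hyb.symm))

theorem IsHauptmodul.multipleValues_eq_empty (hN : Squarefree N) (hj : IsHauptmodul N j) :
    multipleValues N j = ∅ := by
  set B := multipleValues N j
  have hBo : IsOpen B := hj.isOpen_multipleValues hN.ne_zero
  obtain ⟨M, hM⟩ := hj.exists_bound_multipleValues hN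
  have hclopen : IsClopen (interior Bᶜ) := by
    refine ⟨isClosed_of_closure_subset fun w hw => ?_, isOpen_interior⟩
    have hwB : w ∉ B :=
      (closure_minimal interior_subset hBo.isClosed_compl) hw
    rcases hj.eventually_not_mem_or_eventually_mem hN hwB with h | h
    · exact mem_interior_iff_mem_nhds.2 h
    -- Here a punctured neighbourhood of `w` would lie in `B`, so the only nearby point that can lie
    -- in the interior of `Bᶜ` is `w` itself.
    · obtain ⟨V, hV, hVo, hwV⟩ := mem_nhds_iff.1 (eventually_nhdsWithin_iff.1 h)
      obtain ⟨v, hvV, hv⟩ := mem_closure_iff.1 hw V hVo hwV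
      by_cases hvw : v = w
      · rwa [← hvw]
      · exact absurd (hV hvV hvw) (interior_subset hv)
  have hne : (interior Bᶜ).Nonempty := by
    refine ⟨((|M| + 1 : ℝ) : ℂ), mem_interior_iff_mem_nhds.2 ?_⟩
    have hlt : M < ‖((|M| + 1 : ℝ) : ℂ)‖ := by
      rw [Complex.norm_real, Real.norm_of_nonneg (by positivity)]
      exact (le_abs_self M).trans_lt (lt_add_one _)
    filter_upwards [continuous_norm.continuousAt.eventually_const_lt hlt] with w hw hwB
    exact (hM w hwB).not_gt hw
  have huniv := hclopen.eq_univ hne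
  rw [← Set.compl_univ_iff]
  exact Set.univ_subset_iff.1 (huniv ▸ interior_subset)

theorem IsHauptmodul.valueOrder_eq_ord (hN : Squarefree N) (hj : IsHauptmodul N j) (z : ℍ) :
    valueOrder j z = ord N z := by
  refine le_antisymm ?_ (hj.ord_le_valueOrder hN.ne_zero z).1
  by_contra! hlt
  obtain ⟨w, hw⟩ := (hj.eventually_mem_multipleValues hN.ne_zero hlt).exists
  rw [hj.multipleValues_eq_empty hN] at hw
  exact hw

theorem IsHauptmodul.analyticOrderAt_derivH_add_one (hN : Squarefree N) (hj : IsHauptmodul N j)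
    (z : ℍ) : analyticOrderAt (derivH j) (z : ℂ) + 1 = (ord N z : ℕ∞) := by
  rw [hj.derivH_order, hj.valueOrder_eq_ord hN]

theorem IsHauptmodul.derivH_eq_zero_iff (hN : Squarefree N) (hj : IsHauptmodul N j) (z : ℍ) :
    derivH j z = 0 ↔ IsEllipticPoint N z := by
  have hord := hj.analyticOrderAt_derivH_add_one hN z
  have hpos := ord_pos hN.ne_zero z
  rw [isEllipticPoint_iff hN.ne_zero, ← not_iff_not, ← ne_eq (derivH j z),
    ← AnalyticAt.analyticOrderAt_eq_zero (f := derivH j) (hj.analyticAt z).deriv]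
  constructor
  · intro h
    rw [h, zero_add] at hord
    have : ord N z = 1 := by exact_mod_cast hord.symm
    omega
  · intro h
    have h1 : ord N z = 1 := by omega
    rw [h1, Nat.cast_one] at hord
    exact ENat.add_left_injective_of_ne_top ENat.one_ne_top (by simpa using hord)

end Quotient

end GenusZero
end

/-- A Hauptmodul takes no value at two inequivalent points, so at each point the order of its
derivative plus one is the order of the stabilizer; in part (3) the first alternative always
holds. The genus zero hypothesis is already implied by the existence of `j`. -/
theorem mainTheorem3 (N : ℕ) (hN : Squarefree N) (hgenus : GenusZero.HasGenusZero N)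
    (j : UpperHalfPlane → ℂ) (hj : GenusZero.IsHauptmodul N j) :
    (∀ z : UpperHalfPlane, GenusZero.derivH j z = 0 ↔ GenusZero.IsEllipticPoint N z) ∧
    ((¬ ∃ e₀ : UpperHalfPlane, GenusZero.IsEllipticPoint N e₀ ∧
        (GenusZero.ord N e₀ = 4 ∨ GenusZero.ord N e₀ = 6)) →
      ∀ e : UpperHalfPlane, GenusZero.IsEllipticPoint N e →
        analyticOrderAt (GenusZero.derivH j) (e : ℂ) + 1 = (GenusZero.ord N e : ℕ∞)) ∧
    ((∃ e₀ : UpperHalfPlane, GenusZero.IsEllipticPoint N e₀ ∧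
        (GenusZero.ord N e₀ = 4 ∨ GenusZero.ord N e₀ = 6)) →
      (∀ e : UpperHalfPlane, GenusZero.IsEllipticPoint N e →
        analyticOrderAt (GenusZero.derivH j) (e : ℂ) + 1 = (GenusZero.ord N e : ℕ∞)) ∨
      (∃ e₁ : UpperHalfPlane, GenusZero.IsEllipticPoint N e₁ ∧ GenusZero.ord N e₁ = 2 ∧
        ∀ e : UpperHalfPlane, GenusZero.IsEllipticPoint N e →
          (GenusZero.ord N e = 2 → GenusZero.toX N e = GenusZero.toX N e₁ →
            analyticOrderAt (GenusZero.derivH j) (e : ℂ) = 2) ∧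
          (GenusZero.ord N e = 2 → GenusZero.toX N e ≠ GenusZero.toX N e₁ →
            analyticOrderAt (GenusZero.derivH j) (e : ℂ) = 1) ∧
          (GenusZero.ord N e = 4 → analyticOrderAt (GenusZero.derivH j) (e : ℂ) = 1) ∧
          (GenusZero.ord N e = 6 → analyticOrderAt (GenusZero.derivH j) (e : ℂ) = 2))) := by
  exact ⟨fun z => hj.derivH_eq_zero_iff hN z,
    fun _ e _ => hj.analyticOrderAt_derivH_add_one hN e,
    fun _ => Or.inl fun e _ => hj.analyticOrderAt_derivH_add_one hN e⟩
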